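/- **Setting.** A prototile is a labelled closed topological disk in $\mathbb R^d$; a tile is a translate $p+v$ ($v\in\mathbb R^d$) of a prototile, carrying the label along. A patch is a finite collection of tiles which overlap only on their boundaries and whose union (the support of the patch) is connected; a tiling is a collection of tiles which covers $\mathbb R^d$ and whose tiles overlap only on their boundaries. A fusion rule $\mathcal R$ consists of finite sets $\mathcal P_n=\{P_n(1),\dots,P_n(j_n)\}$, $n\ge 0$, where $\mathcal P_0$ is a finite set of prototiles and each $P_{n+1}(j)$, an $(n+1)$-supertile of type $j$, is a patch of translates of elements of $\mathcal P_n$ (with its decomposition into $n$-supertiles fixed; supertiles may carry labels). Let $X^n_{\mathcal R}$ be the set of tilings $T$ by translated $n$-supertiles such that a translate of every patch of $n$-supertiles contained in $T$ is found inside some supertile $P_m(j)$, $m\ge n$, and put $X_{\mathcal R}=X^0_{\mathcal R}$. These spaces carry the topology in which the neighborhoods of $T$ are the sets containing, for some $\varepsilon>0$, all tilings $T'$ that are $\varepsilon$-close to $T$, meaning that there are $g,g'\in\mathbb R^d$ of norm at most $\varepsilon$ such that $T+g$ and $T'+g'$ have the same tiles meeting the closed ball of radius $1/\varepsilon$ around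 the origin. $\mathcal R$ is *recognizable* if for every $n$ the subdivision map $X^{n+1}_{\mathcal R}\to X^n_{\mathcal R}$, which breaks each $(n+1)$-supertile into its $n$-supertiles, is a homeomorphism. $\mathcal R$ *forces the border* if for each $n$ there is an $N$ such that, whenever $S_1$ and $S_2=S_1+v$ are $N$-supertiles of the same type in tilings $T_1,T_2\in X_{\mathcal R}$ (decomposed into $N$-supertiles), translation by $v$ takes the collection of $n$-supertiles of $T_1$ which meet $S_1$ to the collection of $n$-supertiles of $T_2$ which meet $S_2$. The *Anderson–Putnam complex* $\Gamma_n$ is the quotient space of the disjoint union of one copy of the support of each $n$-supertile type that occurs in some tiling in $X^n_{\mathcal R}$, by the equivalence relation generated by: a point $x$ of the copy of $P_n(j)$ and a point $y$ of the copy of $P_n(k)$ are identified if some tiling in $X^n_{\mathcal R}$ contains $P_n(j)+v$ and $P_n(k)+w$ with $x+v=y+w$. The *forgetful map* $f_n:\Gamma_{n+1}\to\Gamma_n$ takes the class of a point $x$ of $P_{n+1}(j)$ to the class of the point $x-u$ of $P_n(k)$, where $P_n(k)+u$ is any constituent of $P_{n+1}(j)$ containing $x$; this is well defined. **Theorem.**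 If the recognizable fusion rule $\mathcal R$ forces the border, then $X_{\mathcal R}$ is homeomorphic to the inverse limit $$\varprojlim(\Gamma_n,f_n)=\Big\{(x_n)_{n\ge0}\in\prod_{n\ge 0}\Gamma_n : f_n(x_{n+1})=x_n\text{ for all }n\Big\},$$ a subspace of the product of the $\Gamma_n$. -/

import Mathlib

open Set Metric Topology
open scoped Pointwise

namespace FusionTiling

/-- Euclidean space of dimension `d`. -/
abbrev Space (d : ℕ) := EuclideanSpace ℝ (Fin d)

/-- A closed topological disk in `ℝ^d`: the image of the closed unit ball under a continuous
injection (hence, by compactness, a homeomorphism onto the image) which carries the open ball onto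
the interior. The last clause is automatic by invariance of domain. -/
def IsClosedDisk {d : ℕ} (K : Set (Space d)) : Prop :=
  ∃ f : Space d → Space d, ContinuousOn f (closedBall 0 1) ∧ InjOn f (closedBall 0 1) ∧
    f '' closedBall 0 1 = K ∧ f '' ball 0 1 = interior K

theorem IsClosedDisk.isConnected {d : ℕ} {K : Set (Space d)} (h : IsClosedDisk K) :
    IsConnected K := by
  obtain ⟨f, hf, -, rfl, -⟩ := h
  refine IsConnected.image ⟨⟨0, by simp⟩, ?_⟩ f hf
  exact (convex_closedBall (0 : Space d) 1).isPreconnected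

/-! ### Tiles, patches, tilings

Tile types are elements of a type `ι`; the type `i` stands for a labelled set `S i ⊆ ℝ^d`. A tile
`(i, v)` is the translate of the labelled set of type `i` by the vector `v`. -/

/-- A tile: a type (label) and a translation vector. -/
abbrev Tile (ι : Type) (d : ℕ) := ι × Space d

section Tiles

variable {ι : Type} {d : ℕ}

/-- The tile `t` translated by `v`. -/
def translate (v : Space d) (t : Tile ι d) : Tile ι d := (t.1, v + t.2)

/-- The closed set covered by a tile. -/
def region (S : ι → Set (Space d)) (t : Tile ι d) : Set (Space d) := t.2 +ᵥ S t.1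

/-- Different tiles of the collection overlap only on their boundaries. -/
def NonOverlapping (S : ι → Set (Space d)) (A : Set (Tile ι d)) : Prop :=
  A.Pairwise fun s t => Disjoint (interior (region S s)) (interior (region S t))

/-- A patch: a finite collection of tiles which overlap only on their boundaries and whose union
is connected. -/
def IsPatch (S : ι → Set (Space d)) (Q : Set (Tile ι d)) : Prop :=
  Q.Finite ∧ NonOverlapping S Q ∧ IsConnected (⋃ t ∈ Q, region S t)

/-- A tiling of `ℝ^d`. -/
def IsTiling (S : ι → Set (Space d)) (T : Set (Tile ι d)) : Prop :=
  NonOverlapping S T ∧ ⋃ t ∈ T, region S t = univ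

/-- The tiles of `T` which meet the set `K`. -/
def touching (S : ι → Set (Space d)) (T : Set (Tile ι d)) (K : Set (Space d)) :
    Set (Tile ι d) :=
  {t ∈ T | (region S t ∩ K).Nonempty}

/-- `T` and `T'` are `ε`-close: up to translations of size at most `ε`, they exactly agree on the
ball of radius `1/ε` around the origin. -/
def Close (S : ι → Set (Space d)) (ε : ℝ) (T T' : Set (Tile ι d)) : Prop :=
  ∃ g g' : Space d, ‖g‖ ≤ ε ∧ ‖g'‖ ≤ ε ∧
    touching S (translate g '' T) (closedBall 0 (1 / ε)) =
      touching S (translate g' '' T') (closedBall 0 (1 / ε))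

theorem touching_mono {S : ι → Set (Space d)} {T T' : Set (Tile ι d)} {K L : Set (Space d)}
    (h : touching S T L = touching S T' L) (hKL : K ⊆ L) :
    touching S T K = touching S T' K := by
  have key : ∀ t, (region S t ∩ K).Nonempty → (t ∈ T ↔ t ∈ T') := by
    intro t ht
    have hL : (region S t ∩ L).Nonempty := ht.mono (inter_subset_inter_right _ hKL)
    have := Set.ext_iff.1 h t
    simp only [touching, mem_ofPred_eq, hL, and_true] at this
    exact this
  ext t
  simp only [touching, mem_ofPred_eq]
  exact and_congr_left (key t)

theorem Close.mono {S : ι → Set (Space d)} {ε δ : ℝ} (hε : 0 < ε) (h : ε ≤ δ)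
    {T T' : Set (Tile ι d)} (hc : Close S ε T T') : Close S δ T T' := by
  obtain ⟨g, g', hg, hg', e⟩ := hc
  exact ⟨g, g', hg.trans h, hg'.trans h,
    touching_mono e (closedBall_subset_closedBall (one_div_le_one_div_of_le hε h))⟩

theorem region_translate (S : ι → Set (Space d)) (v : Space d) (t : Tile ι d) :
    region S (translate v t) = v +ᵥ region S t := by
  simp only [region, translate, add_vadd]

end Tiles

/-! ### Fusion rules -/

/-- The raw data of a fusion rule: `num n` is the number of types of `n`-supertiles; `proto` gives
the sets underlying the prototiles (the `0`-supertiles); `parts n j` is the collection of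
`n`-supertiles, given by type and position, out of which the `(n+1)`-supertile of type `j` is
fused. Types are labels, so supertiles of different types may have the same underlying set. -/
structure FusionData (d : ℕ) where
  num : ℕ → ℕ
  proto : Fin (num 0) → Set (Space d)
  parts : ∀ n, Fin (num (n + 1)) → Set (Tile (Fin (num n)) d)

/-- The support of the `n`-supertile of type `j` in its standard position. -/
def FusionData.supp {d : ℕ} (R : FusionData d) : ∀ n, Fin (R.num n) → Set (Space d)
  | 0, j => R.proto j
  | n + 1, j => ⋃ t ∈ R.parts n j, region (R.supp n) t

/-- A fusion rule: prototiles are closed topological disks, and each `(n+1)`-supertile is a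
patch of `n`-supertiles. -/
structure FusionRule (d : ℕ) extends FusionData d where
  proto_disk : ∀ i, IsClosedDisk (proto i)
  parts_patch : ∀ n j, IsPatch (toFusionData.supp n) (parts n j)

namespace FusionRule

variable {d : ℕ} (R : FusionRule d)

/-- `n`-supertiles, placed in `ℝ^d`. -/
abbrev STile (n : ℕ) := Tile (Fin (R.num n)) d

/-- The closed set covered by an `n`-supertile. -/
abbrev reg (n : ℕ) (t : R.STile n) : Set (Space d) := region (R.supp n) t

/-- `R.Piece n m j t` says that the `n`-supertile `t` is one of the `n`-supertiles that make up
the `m`-supertile of type `j` (in standard position), obtained by repeatedly decomposing it. -/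
inductive Piece (n : ℕ) : ∀ m : ℕ, Fin (R.num m) → R.STile n → Prop
  | self (j : Fin (R.num n)) : Piece n n j (j, 0)
  | sub {m : ℕ} {j : Fin (R.num (m + 1))} {s : R.STile m} {t : R.STile n}
      (hs : s ∈ R.parts m j) (ht : Piece n m s.1 t) : Piece n (m + 1) j (translate s.2 t)

/-- A collection of `n`-supertiles is admitted if a copy of it is found inside some supertile. -/
def Admitted (n : ℕ) (Q : Set (R.STile n)) : Prop :=
  ∃ (m : ℕ) (j : Fin (R.num m)) (v : Space d), ∀ t ∈ Q, R.Piece n m j (translate v t)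

/-- The space of tilings by `n`-supertiles all of whose patches are admitted; for `n = 0` this is
the space of fusion tilings of the rule. -/
@[ext] structure TilingSpace (n : ℕ) where
  tiles : Set (R.STile n)
  isTiling : IsTiling (R.supp n) tiles
  admitted : ∀ Q ⊆ tiles, IsPatch (R.supp n) Q → R.Admitted n Q

/-- The topology of the "big ball" metric: a set is open if with each tiling `T` it contains all
tilings `ε`-close to `T`, for some `ε > 0`. -/
instance (n : ℕ) : TopologicalSpace (R.TilingSpace n) where
  IsOpen U := ∀ T ∈ U, ∃ ε > 0, ∀ T' : R.TilingSpace n,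
    Close (R.supp n) ε T.tiles T'.tiles → T' ∈ U
  isOpen_univ := fun _ _ => ⟨1, one_pos, fun _ _ => mem_univ _⟩
  isOpen_inter := by
    rintro U V hU hV T ⟨hTU, hTV⟩
    obtain ⟨ε, hε, h1⟩ := hU T hTU
    obtain ⟨δ, hδ, h2⟩ := hV T hTV
    have hm : 0 < min ε δ := lt_min hε hδ
    exact ⟨min ε δ, hm, fun T' hc =>
      ⟨h1 T' (hc.mono hm (min_le_left _ _)), h2 T' (hc.mono hm (min_le_right _ _))⟩⟩
  isOpen_sUnion := by
    rintro 𝒰 h𝒰 T ⟨U, hU, hT⟩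
    obtain ⟨ε, hε, h⟩ := h𝒰 U hU T hT
    exact ⟨ε, hε, fun T' hc => ⟨U, hU, h T' hc⟩⟩

theorem supp_isConnected : ∀ (n : ℕ) (j : Fin (R.num n)), IsConnected (R.supp n j)
  | 0, j => (R.proto_disk j).isConnected
  | n + 1, j => (R.parts_patch n j).2.2

theorem reg_isConnected (n : ℕ) (t : R.STile n) : IsConnected (R.reg n t) := by
  have := (R.supp_isConnected n t.1).image (fun x => t.2 +ᵥ x) (by fun_prop)
  exact this

/-- A constituent of an `(n+1)`-supertile is contained in it. -/
theorem reg_part_subset {n : ℕ} {s : R.STile (n + 1)} {u : R.STile n}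
    (hu : u ∈ R.parts n s.1) : R.reg n (translate s.2 u) ⊆ R.reg (n + 1) s := by
  rw [reg, region_translate]
  exact vadd_set_mono (subset_biUnion_of_mem (u := region (R.supp n)) hu)

theorem exists_part {n : ℕ} {j : Fin (R.num (n + 1))} {x : Space d} (hx : x ∈ R.supp (n + 1) j) :
    ∃ u ∈ R.parts n j, x ∈ R.reg n u := by
  have hx' : x ∈ ⋃ t ∈ R.parts n j, region (R.supp n) t := hx
  simpa only [mem_iUnion, exists_prop] using hx'

theorem Piece.part {n m : ℕ} {j : Fin (R.num m)} {s : R.STile (n + 1)}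
    (h : R.Piece (n + 1) m j s) {u : R.STile n} (hu : u ∈ R.parts n s.1) :
    R.Piece n m j (translate s.2 u) := by
  induction h with
  | self j =>
    have := Piece.sub (R := R) hu (Piece.self (R := R) u.1)
    simpa [translate] using this
  | sub hs _ ih =>
    have := Piece.sub (R := R) hs (ih hu)
    simpa [translate, add_assoc] using this

/-- The `n`-supertiles obtained by breaking each `(n+1)`-supertile of `T`. -/
def subdivideSet (n : ℕ) (T : Set (R.STile (n + 1))) : Set (R.STile n) :=
  {t | ∃ s ∈ T, ∃ u ∈ R.parts n s.1, t = translate s.2 u}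

theorem subdivideSet_isTiling {n : ℕ} {T : Set (R.STile (n + 1))}
    (hT : IsTiling (R.supp (n + 1)) T) : IsTiling (R.supp n) (R.subdivideSet n T) := by
  refine ⟨?_, ?_⟩
  · rintro _ ⟨s, hs, u, hu, rfl⟩ _ ⟨s', hs', u', hu', rfl⟩ hne
    by_cases hss : s = s'
    · subst hss
      have huu : u ≠ u' := fun h => hne (by rw [h])
      have hd : Disjoint (interior (region (R.supp n) u)) (interior (region (R.supp n) u')) :=
        (R.parts_patch n s.1).2.1 hu hu' huu
      simp only [region_translate, interior_vadd]
      rw [Set.disjoint_left] at hd ⊢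
      rintro _ ⟨x, hx, rfl⟩ ⟨y, hy, hxy⟩
      have : y = x := by simpa using hxy
      exact hd hx (this ▸ hy)
    · exact (hT.1 hs hs' hss).mono (interior_mono (R.reg_part_subset hu))
        (interior_mono (R.reg_part_subset hu'))
  · refine eq_univ_of_forall fun x => ?_
    have hx : x ∈ ⋃ t ∈ T, region (R.supp (n + 1)) t := hT.2 ▸ mem_univ x
    simp only [mem_iUnion, exists_prop] at hx ⊢
    obtain ⟨s, hs, y, hy, rfl⟩ := hx
    obtain ⟨u, hu, hyu⟩ := R.exists_part hy
    refine ⟨translate s.2 u, ⟨s, hs, u, hu, rfl⟩, ?_⟩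
    rw [region_translate]
    exact vadd_mem_vadd_set hyu

theorem subdivideSet_admitted {n : ℕ} (T : R.TilingSpace (n + 1)) (Q : Set (R.STile n))
    (hQT : Q ⊆ R.subdivideSet n T.tiles) (hQ : IsPatch (R.supp n) Q) : R.Admitted n Q := by
  obtain ⟨x, hx⟩ := hQ.2.2.nonempty
  simp only [mem_iUnion, exists_prop] at hx
  obtain ⟨t₀, ht₀, -⟩ := hx
  obtain ⟨s₀, -, -, -, -⟩ := hQT ht₀
  have : Nonempty (R.STile (n + 1)) := ⟨s₀⟩
  have : Nonempty (R.STile n) := ⟨t₀⟩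
  have hQT' : ∀ t ∈ Q, ∃ s ∈ T.tiles, ∃ u ∈ R.parts n s.1, t = translate s.2 u :=
    fun t ht => hQT ht
  choose! f hf u hu htu using hQT'
  have hsub : ∀ t ∈ Q, R.reg n t ⊆ R.reg (n + 1) (f t) := by
    intro t ht
    have := R.reg_part_subset (hu t ht)
    rwa [← htu t ht] at this
  set C : Set (Space d) := ⋃ t ∈ Q, region (R.supp n) t with hC
  have hPT : f '' Q ⊆ T.tiles := by
    rintro _ ⟨t, ht, rfl⟩
    exact hf t ht
  have hCP : C ⊆ ⋃ s ∈ f '' Q, region (R.supp (n + 1)) s := by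
    intro x hx
    simp only [hC, mem_iUnion, exists_prop] at hx
    obtain ⟨t, ht, hxt⟩ := hx
    simp only [mem_iUnion, exists_prop]
    exact ⟨f t, ⟨t, ht, rfl⟩, hsub t ht hxt⟩
  have hP : IsPatch (R.supp (n + 1)) (f '' Q) := by
    refine ⟨hQ.1.image f, T.isTiling.1.mono hPT, ?_⟩
    obtain ⟨x₀, hx₀⟩ := hQ.2.2.nonempty
    refine ⟨⟨x₀, hCP hx₀⟩, isPreconnected_of_forall x₀ ?_⟩
    intro y hy
    simp only [mem_iUnion, exists_prop] at hy
    obtain ⟨_, ⟨t, ht, rfl⟩, hyt⟩ := hy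
    refine ⟨C ∪ R.reg (n + 1) (f t), union_subset hCP ?_, Or.inl hx₀, Or.inr hyt, ?_⟩
    · exact subset_biUnion_of_mem (u := region (R.supp (n + 1))) (mem_image_of_mem f ht)
    · obtain ⟨z, hz⟩ := (R.reg_isConnected n t).nonempty
      refine IsPreconnected.union z ?_ (hsub t ht hz) hQ.2.2.isPreconnected
        (R.reg_isConnected (n + 1) (f t)).isPreconnected
      exact subset_biUnion_of_mem (u := region (R.supp n)) ht hz
  obtain ⟨m, j, v, h⟩ := T.admitted _ hPT hP
  refine ⟨m, j, v, fun t ht => ?_⟩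
  have h1 := Piece.part R (h (f t) (mem_image_of_mem f ht)) (u := u t) (hu t ht)
  have h2 : translate v t = translate (translate v (f t)).2 (u t) := by
    conv_lhs => rw [htu t ht]
    simp [translate, add_assoc]
  rw [h2]
  exact h1

/-- The subdivision map, from tilings by `(n+1)`-supertiles to tilings by `n`-supertiles. -/
def subdivide (n : ℕ) (T : R.TilingSpace (n + 1)) : R.TilingSpace n where
  tiles := R.subdivideSet n T.tiles
  isTiling := R.subdivideSet_isTiling T.isTiling
  admitted := R.subdivideSet_admitted T

/-- A fusion rule is recognizable if all subdivision maps are homeomorphisms. -/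
def Recognizable : Prop := ∀ n, IsHomeomorph (R.subdivide n)

/-- The ordinary tiling underlying a tiling by `n`-supertiles. -/
def toBase : ∀ n, R.TilingSpace n → R.TilingSpace 0
  | 0, T => T
  | n + 1, T => toBase n (R.subdivide n T)

/-- A fusion rule forces the border if for each `n` there is an `N` such that, whenever `S₁`, `S₂`
are `N`-supertiles of the same type in tilings `T₁`, `T₂`, the translation which takes `S₁` to
`S₂` takes the patch of `n`-supertiles touching `S₁` in `T₁` to the patch of `n`-supertiles
touching `S₂` in `T₂`. Here `A₁`, `A₂` are the decompositions of `T₁`, `T₂` into `n`-supertiles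
and `B₁`, `B₂` those into `N`-supertiles. -/
def ForcesBorder : Prop :=
  ∀ n, ∃ N, ∀ (T₁ T₂ : R.TilingSpace 0) (A₁ A₂ : R.TilingSpace n) (B₁ B₂ : R.TilingSpace N),
    R.toBase n A₁ = T₁ → R.toBase N B₁ = T₁ → R.toBase n A₂ = T₂ → R.toBase N B₂ = T₂ →
    ∀ S₁ ∈ B₁.tiles, ∀ S₂ ∈ B₂.tiles, S₁.1 = S₂.1 →
      translate (S₂.2 - S₁.2) '' touching (R.supp n) A₁.tiles (R.reg N S₁) =
        touching (R.supp n) A₂.tiles (R.reg N S₂)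

/-! ### The Anderson–Putnam complexes and their inverse limit -/

/-- The `n`-supertile type `j` occurs in some tiling. -/
def Occurs (n : ℕ) (j : Fin (R.num n)) : Prop :=
  ∃ T : R.TilingSpace n, ∃ v : Space d, (j, v) ∈ T.tiles

/-- The disjoint union of one copy of each occurring `n`-supertile. -/
abbrev Cells (n : ℕ) := Σ j : {j : Fin (R.num n) // R.Occurs n j}, R.supp n j.1

/-- Points `p`, `q` correspond to each other: somewhere in some tiling by `n`-supertiles there are
supertiles of the types of `p` and of `q` which meet in a point having the position of `p` in the
first and that of `q` in the second. -/
def Meet (n : ℕ) (p q : R.Cells n) : Prop :=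
  ∃ T : R.TilingSpace n, ∃ v w : Space d, (p.1.1, v) ∈ T.tiles ∧ (q.1.1, w) ∈ T.tiles ∧
    v + (p.2 : Space d) = w + (q.2 : Space d)

/-- The `n`-th Anderson–Putnam complex: the quotient of the disjoint union of the `n`-supertiles
by the equivalence relation generated by `Meet`, with the quotient topology. -/
def Complex (n : ℕ) : Type := Quot (R.Meet n)

instance (n : ℕ) : TopologicalSpace (R.Complex n) :=
  inferInstanceAs (TopologicalSpace (Quot (R.Meet n)))

theorem Occurs.part {n : ℕ} {j : Fin (R.num (n + 1))} (h : R.Occurs (n + 1) j)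
    {u : R.STile n} (hu : u ∈ R.parts n j) : R.Occurs n u.1 := by
  obtain ⟨T, v, hT⟩ := h
  exact ⟨R.subdivide n T, v + u.2, (j, v), hT, u, hu, rfl⟩

/-- The point of the `n`-supertile `u` inside the `(n+1)`-supertile of `p` which lies at `p`. -/
def childPoint {n : ℕ} (p : R.Cells (n + 1)) (u : R.STile n) (hu : u ∈ R.parts n p.1.1)
    (hp : (p.2 : Space d) ∈ R.reg n u) : R.Cells n :=
  ⟨⟨u.1, Occurs.part R p.1.2 hu⟩,
    ⟨(p.2 : Space d) - u.2, by
      obtain ⟨y, hy, hyp⟩ := hp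
      have hyp' : u.2 + y = (p.2 : Space d) := hyp
      rw [← hyp', add_sub_cancel_left]
      exact hy⟩⟩

theorem Meet.child {n : ℕ} {p q : R.Cells (n + 1)} (h : R.Meet (n + 1) p q)
    {u w : R.STile n} (hu : u ∈ R.parts n p.1.1) (hp : (p.2 : Space d) ∈ R.reg n u)
    (hw : w ∈ R.parts n q.1.1) (hq : (q.2 : Space d) ∈ R.reg n w) :
    R.Meet n (R.childPoint p u hu hp) (R.childPoint q w hw hq) := by
  obtain ⟨T, a, b, ha, hb, hab⟩ := h
  refine ⟨R.subdivide n T, a + u.2, b + w.2, ⟨_, ha, u, hu, rfl⟩, ⟨_, hb, w, hw, rfl⟩, ?_⟩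
  simp only [childPoint]
  rw [add_assoc, add_sub_cancel, add_assoc, add_sub_cancel]
  exact hab

theorem Meet.rfl {n : ℕ} (p : R.Cells n) : R.Meet n p p := by
  obtain ⟨T, v, hT⟩ := p.1.2
  exact ⟨T, v, v, hT, hT, Eq.refl _⟩

/-- The forgetful map: a point in an `(n+1)`-supertile is sent to its place in the `n`-supertile
of which it is a point. -/
noncomputable def forget (n : ℕ) : R.Complex (n + 1) → R.Complex n :=
  Quot.lift
    (fun p => Quot.mk _ (R.childPoint p (R.exists_part p.2.2).choose
      (R.exists_part p.2.2).choose_spec.1 (R.exists_part p.2.2).choose_spec.2))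
    (fun _ _ h => Quot.sound (Meet.child R h _ _ _ _))

/-- The forgetful map does not depend on the choice of the `n`-supertile containing the point. -/
theorem forget_mk {n : ℕ} (p : R.Cells (n + 1)) (u : R.STile n) (hu : u ∈ R.parts n p.1.1)
    (hp : (p.2 : Space d) ∈ R.reg n u) :
    R.forget n (Quot.mk _ p) = Quot.mk _ (R.childPoint p u hu hp) :=
  Quot.sound (Meet.child R (Meet.rfl R p) _ _ _ _)

/-- The inverse limit of the Anderson–Putnam complexes under the forgetful maps, as a subspace of
the product. -/
abbrev InverseLimit := {x : ∀ n, R.Complex n // ∀ n, R.forget n (x (n + 1)) = x n}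

end FusionRule

end FusionTiling

/-!
By recognizability every tiling `T` has a unique hierarchy `level T n` of decompositions into
`n`-supertiles, depending continuously on `T`. The homeomorphism sends `T` to the sequence of points
of the Anderson–Putnam complexes which record where the origin lies in the `n`-supertiles
(`toInverseLimit`). It is continuous because tilings are locally finite
(`continuous_originClass`).

The inverse is governed by `Determines n N ρ`: an `N`-supertile at `x` fixes all `n`-supertiles
within distance `ρ` of `x`. Border forcing gives this for touching supertiles only, and the
supertiles of a fusion rule need not grow, so one has to see that it gives it for every `ρ`. Border
forcing at level `0` leaves finitely many tile configurations around the `N`-supertiles, up to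
translation, hence a distance `r > 0` below which a tile and an `N`-supertile touch
(`exists_meets_of_dist_lt`). Consequently one application of border forcing controls the ball of
radius `r / 2` at every level (`exists_determines`), and iterating it through the levels adds up the
radii (`exists_determines_radius`). If points of two `N`-supertiles are identified in the complex,
a chain of tilings in which such points meet shows that both supertiles fix the same supertiles
around the point (`Determines.mem_of_originClass_eq`). So the `N`-th coordinate of
`toInverseLimit T` determines `T` on a ball which becomes arbitrarily large with `N`.

Injectivity is then immediate. For surjectivity, tilings realizing the successive coordinates agree
on growing balls, at all levels of the hierarchy, and their limit is the required tiling. For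
openness, a tiling whose `N`-th coordinate is near that of `T` agrees with `T` on a large ball up to
a small translation (`Determines.isOpen_setOf_agree`).
-/

namespace FusionTiling

/-! ### Translations of collections of tiles -/

section Translation

variable {ι : Type} {d : ℕ} {S : ι → Set (Space d)}

theorem translate_translate (v w : Space d) (t : Tile ι d) :
    translate v (translate w t) = translate (v + w) t := by
  simp [translate, add_assoc]

@[simp] theorem translate_zero (t : Tile ι d) : translate 0 t = t := by
  simp [translate]

theorem mem_image_translate {v : Space d} {T : Set (Tile ι d)} {t : Tile ι d} :
    t ∈ translate v '' T ↔ translate (-v) t ∈ T := by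
  constructor
  · rintro ⟨s, hs, rfl⟩
    simpa [translate_translate] using hs
  · exact fun h => ⟨_, h, by simp [translate_translate]⟩

theorem translate_image_image (v w : Space d) (T : Set (Tile ι d)) :
    translate v '' (translate w '' T) = translate (v + w) '' T := by
  simp only [image_image, translate_translate]

theorem mem_region {t : Tile ι d} {x : Space d} : x ∈ region S t ↔ x - t.2 ∈ S t.1 := by
  rw [region, mem_vadd_set_iff_neg_vadd_mem, vadd_eq_add, neg_add_eq_sub]

theorem mem_region_translate {v x : Space d} {t : Tile ι d} :
    x ∈ region S (translate v t) ↔ x - v ∈ region S t := by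
  rw [mem_region, mem_region, translate, sub_sub]

theorem NonOverlapping.image_translate {A : Set (Tile ι d)} (hA : NonOverlapping S A)
    (v : Space d) : NonOverlapping S (translate v '' A) := by
  rintro _ ⟨s, hs, rfl⟩ _ ⟨t, ht, rfl⟩ hne
  have hd : Disjoint (interior (region S s)) (interior (region S t)) :=
    hA hs ht fun h => hne (by rw [h])
  simp only [region_translate, interior_vadd]
  exact disjoint_vadd_set.2 hd

theorem biUnion_region_image_translate (A : Set (Tile ι d)) (v : Space d) :
    ⋃ t ∈ translate v '' A, region S t = v +ᵥ ⋃ t ∈ A, region S t := by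
  ext x
  simp only [biUnion_image, mem_vadd_set_iff_neg_vadd_mem, vadd_eq_add, mem_iUnion,
    mem_region_translate, neg_add_eq_sub]

theorem IsTiling.image_translate {T : Set (Tile ι d)} (hT : IsTiling S T) (v : Space d) :
    IsTiling S (translate v '' T) :=
  ⟨hT.1.image_translate v, by rw [biUnion_region_image_translate, hT.2, vadd_set_univ]⟩

theorem IsPatch.image_translate {Q : Set (Tile ι d)} (hQ : IsPatch S Q) (v : Space d) :
    IsPatch S (translate v '' Q) := by
  refine ⟨hQ.1.image _, hQ.2.1.image_translate v, ?_⟩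
  rw [biUnion_region_image_translate]
  exact hQ.2.2.image (fun x => v +ᵥ x) (by fun_prop)

theorem IsTiling.exists_mem {T : Set (Tile ι d)} (hT : IsTiling S T) (x : Space d) :
    ∃ t ∈ T, x ∈ region S t := by
  have hx : x ∈ ⋃ t ∈ T, region S t := hT.2 ▸ mem_univ x
  simpa only [mem_iUnion, exists_prop] using hx

end Translation

/-! ### The shape of supertiles and local finiteness -/

theorem IsClosedDisk.isCompact {d : ℕ} {K : Set (Space d)} (h : IsClosedDisk K) :
    IsCompact K := by
  obtain ⟨f, hf, -, rfl, -⟩ := h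
  exact (isCompact_closedBall 0 1).image_of_continuousOn hf

theorem IsClosedDisk.nonempty_interior {d : ℕ} {K : Set (Space d)} (h : IsClosedDisk K) :
    (interior K).Nonempty := by
  obtain ⟨f, -, -, -, hf⟩ := h
  rw [← hf]
  exact ⟨f 0, mem_image_of_mem f (mem_ball_self one_pos)⟩

theorem IsClosedDisk.subset_closure_interior {d : ℕ} {K : Set (Space d)} (h : IsClosedDisk K) :
    K ⊆ closure (interior K) := by
  obtain ⟨f, hf, -, rfl, hi⟩ := h
  rw [← hi, ← closure_ball (0 : Space d) one_ne_zero] at *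
  exact hf.image_closure

namespace FusionRule

variable {d : ℕ} (R : FusionRule d)

theorem isCompact_supp : ∀ (n : ℕ) (j : Fin (R.num n)), IsCompact (R.supp n j)
  | 0, j => (R.proto_disk j).isCompact
  | n + 1, j => (R.parts_patch n j).1.isCompact_biUnion fun t _ =>
      (isCompact_supp n t.1).vadd t.2

theorem isCompact_reg (n : ℕ) (t : R.STile n) : IsCompact (R.reg n t) :=
  (R.isCompact_supp n t.1).vadd t.2

theorem nonempty_interior_supp :
    ∀ (n : ℕ) (j : Fin (R.num n)), (interior (R.supp n j)).Nonempty
  | 0, j => (R.proto_disk j).nonempty_interior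
  | n + 1, j => by
    obtain ⟨x, hx⟩ := (R.supp_isConnected (n + 1) j).nonempty
    obtain ⟨u, hu, -⟩ := R.exists_part hx
    have hsub : R.reg n u ⊆ R.supp (n + 1) j :=
      subset_biUnion_of_mem (u := region (R.supp n)) hu
    refine Nonempty.mono (interior_mono hsub) ?_
    rw [reg, region, interior_vadd]
    exact (nonempty_interior_supp n u.1).vadd_set

theorem reg_zero_subset_closure_interior (t : R.STile 0) :
    R.reg 0 t ⊆ closure (interior (R.reg 0 t)) := by
  rw [reg, region, interior_vadd, closure_vadd]
  exact vadd_set_mono (R.proto_disk t.1).subset_closure_interior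

/-- Tilings by supertiles are locally finite: the positions of the tiles of a given type are
separated, because the interiors of these tiles are disjoint. -/
theorem finite_touching_closedBall {n : ℕ} {T : Set (R.STile n)} (hT : IsTiling (R.supp n) T)
    (ρ : ℝ) : (touching (R.supp n) T (closedBall 0 ρ)).Finite := by
  have key : ∀ j : Fin (R.num n),
      {t ∈ touching (R.supp n) T (closedBall 0 ρ) | t.1 = j}.Finite := by
    intro j
    obtain ⟨D, hD⟩ := (R.isCompact_supp n j).isBounded.subset_closedBall 0
    obtain ⟨c, hc⟩ := R.nonempty_interior_supp n j
    obtain ⟨δ, hδ, hball⟩ := Metric.isOpen_iff.1 isOpen_interior c hc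
    obtain ⟨F, hF, hcover⟩ := Metric.totallyBounded_iff.1
      (isCompact_closedBall (0 : Space d) (ρ + D)).totallyBounded (δ / 2) (half_pos hδ)
    refine (hF.biUnion (t := fun y => {t : R.STile n | t ∈ T ∧ t.1 = j ∧ t.2 ∈ ball y (δ / 2)})
      fun y _ => Set.Subsingleton.finite ?_).subset ?_
    · rintro ⟨i, v⟩ ⟨hv, rfl, hvy⟩ ⟨i', w⟩ ⟨hw, hi', hwy⟩
      obtain rfl : i' = i := hi'
      by_contra hne
      have hdist : dist v w < δ := by
        have := dist_triangle_right v w y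
        have h1 := mem_ball.1 hvy
        have h2 := mem_ball.1 hwy
        linarith
      refine Set.disjoint_left.1 (hT.1 hv hw hne) (?_ : v + c ∈ _) ?_
      · rw [region, interior_vadd]
        exact vadd_mem_vadd_set hc
      · rw [region, interior_vadd, mem_vadd_set_iff_neg_vadd_mem]
        refine hball ?_
        have : -w + (v + c) - c = v - w := by abel
        rw [vadd_eq_add, mem_ball, dist_eq_norm, this, ← dist_eq_norm]
        exact hdist
    · rintro t ⟨⟨ht, x, hxt, hx⟩, rfl⟩
      have h1 : ‖x - t.2‖ ≤ D := by simpa using hD (mem_region.1 hxt)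
      have h2 : ‖x‖ ≤ ρ := by simpa using hx
      have h3 : t.2 ∈ closedBall (0 : Space d) (ρ + D) := by
        rw [mem_closedBall_zero_iff]
        calc ‖t.2‖ = ‖x - (x - t.2)‖ := by rw [sub_sub_cancel]
          _ ≤ ‖x‖ + ‖x - t.2‖ := norm_sub_le _ _
          _ ≤ ρ + D := add_le_add h2 h1
      have h4 := hcover h3
      simp only [mem_iUnion, exists_prop] at h4 ⊢
      obtain ⟨y, hy, hty⟩ := h4
      exact ⟨y, hy, ht, rfl, hty⟩
  refine (Set.finite_iUnion key).subset fun t ht => ?_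
  exact mem_iUnion.2 ⟨t.1, ht, rfl⟩

/-- The supertiles of a tiling which meet a compact set `K` cover a neighbourhood of `K`. -/
theorem exists_thickening_subset {n : ℕ} {T : Set (R.STile n)} (hT : IsTiling (R.supp n) T)
    {K : Set (Space d)} (hK : IsCompact K) :
    ∃ δ > 0, thickening δ K ⊆ ⋃ t ∈ touching (R.supp n) T K, R.reg n t := by
  obtain ⟨ρ, hρ⟩ := hK.isBounded.subset_closedBall 0
  have hopen : IsOpen ((ball (0 : Space d) (ρ + 1)) ∩
      (⋃ t ∈ touching (R.supp n) T (closedBall 0 (ρ + 1)) \ touching (R.supp n) T K,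
        R.reg n t)ᶜ) := by
    refine isOpen_ball.inter (IsClosed.isOpen_compl (self := ?_))
    exact ((R.finite_touching_closedBall hT _).subset sdiff_subset).isClosed_biUnion
      fun t _ => (R.isCompact_reg n t).isClosed
  obtain ⟨δ, hδ, h⟩ := hK.exists_thickening_subset_open hopen (by
    intro x hx
    refine ⟨closedBall_subset_ball (lt_add_one ρ) (hρ hx), ?_⟩
    simp only [mem_compl_iff, mem_iUnion, not_exists]
    rintro t ⟨⟨htT, -⟩, ht⟩ hxt
    exact ht ⟨htT, x, hxt, hx⟩)
  refine ⟨δ, hδ, fun y hy => ?_⟩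
  obtain ⟨hy1, hy2⟩ := h hy
  obtain ⟨t, ht, hyt⟩ := hT.exists_mem y
  simp only [mem_compl_iff, mem_iUnion, not_exists, exists_prop, not_and] at hy2 ⊢
  refine ⟨t, ?_, hyt⟩
  by_contra hn
  exact hy2 t ⟨⟨ht, y, hyt, ball_subset_closedBall hy1⟩, hn⟩ hyt

/-! ### The action of translations on the tiling spaces and the hierarchy of a tiling -/

variable {R}

theorem Admitted.image_translate {n : ℕ} {Q : Set (R.STile n)} (h : R.Admitted n Q)
    (v : Space d) : R.Admitted n (translate v '' Q) := by
  obtain ⟨m, j, w, hw⟩ := h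
  refine ⟨m, j, w - v, ?_⟩
  rintro _ ⟨t, ht, rfl⟩
  rw [translate_translate, sub_add_cancel]
  exact hw t ht

/-- The tiling `T` translated by `v`; it consists of the tiles `t + v` with `t` in `T`. -/
def TilingSpace.shift {n : ℕ} (v : Space d) (T : R.TilingSpace n) : R.TilingSpace n where
  tiles := translate v '' T.tiles
  isTiling := T.isTiling.image_translate v
  admitted := by
    intro Q hQT hQ
    have hsub : translate (-v) '' Q ⊆ T.tiles := by
      rintro _ ⟨t, ht, rfl⟩
      exact mem_image_translate.1 (hQT ht)
    have h := (T.admitted _ hsub (hQ.image_translate (-v))).image_translate v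
    rw [translate_image_image, add_neg_cancel] at h
    simpa using h

theorem subdivide_shift {n : ℕ} (v : Space d) (T : R.TilingSpace (n + 1)) :
    R.subdivide n (T.shift v) = (R.subdivide n T).shift v := by
  ext t
  constructor
  · rintro ⟨_, ⟨s, hs, rfl⟩, u, hu, rfl⟩
    exact ⟨_, ⟨s, hs, u, hu, rfl⟩, translate_translate _ _ _⟩
  · rintro ⟨_, ⟨s, hs, u, hu, rfl⟩, rfl⟩
    exact ⟨_, ⟨s, hs, rfl⟩, u, hu, translate_translate _ _ _⟩

/-- The decomposition of a tiling into `n`-supertiles, which exists uniquely if the rule is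
recognizable. -/
noncomputable def level (hrec : R.Recognizable) (T : R.TilingSpace 0) : ∀ n, R.TilingSpace n
  | 0 => T
  | n + 1 => ((hrec n).homeomorph _).symm (level hrec T n)

variable (hrec : R.Recognizable)

theorem subdivide_level (T : R.TilingSpace 0) (n : ℕ) :
    R.subdivide n (level hrec T (n + 1)) = level hrec T n :=
  ((hrec n).homeomorph _).apply_symm_apply _

theorem continuous_level (n : ℕ) : Continuous fun T => level hrec T n := by
  induction n with
  | zero => exact continuous_id
  | succ n ih => exact ((hrec n).homeomorph _).symm.continuous.comp ih

theorem toBase_level (T : R.TilingSpace 0) (n : ℕ) : R.toBase n (level hrec T n) = T := by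
  induction n with
  | zero => rfl
  | succ n ih => rw [toBase, subdivide_level, ih]

/-- A compatible sequence of tilings by supertiles is the hierarchy of its first member. -/
theorem level_eq {B : ∀ n, R.TilingSpace n} (hB : ∀ n, R.subdivide n (B (n + 1)) = B n) (n : ℕ) :
    level hrec (B 0) n = B n := by
  induction n with
  | zero => rfl
  | succ n ih => exact (hrec n).bijective.1 (by rw [subdivide_level, hB, ih])

theorem level_toBase (n : ℕ) (A : R.TilingSpace n) : level hrec (R.toBase n A) n = A := by
  induction n with
  | zero => rfl
  | succ n ih => exact (hrec n).bijective.1 (by rw [subdivide_level, toBase, ih])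

theorem level_shift (v : Space d) (T : R.TilingSpace 0) (n : ℕ) :
    level hrec (T.shift v) n = (level hrec T n).shift v :=
  level_eq hrec (B := fun n => (level hrec T n).shift v)
    (fun n => by rw [subdivide_shift, subdivide_level]) n

/-- A point of an `N`-supertile lies in an `n`-supertile of it, for every `n ≤ N`. -/
theorem exists_subtile {n N : ℕ} (h : n ≤ N) {S : R.STile N} {x : Space d} (hx : x ∈ R.reg N S) :
    ∃ s : R.STile n, x ∈ R.reg n s ∧ R.reg n s ⊆ R.reg N S ∧
      ∀ T, S ∈ (level hrec T N).tiles → s ∈ (level hrec T n).tiles := by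
  induction N, h using Nat.le_induction with
  | base => exact ⟨S, hx, Subset.rfl, fun T hT => hT⟩
  | succ N _ ih =>
    obtain ⟨u, hu, hxu⟩ := R.exists_part (mem_region.1 hx)
    obtain ⟨s, hxs, hsu, hs⟩ := ih (mem_region_translate.2 hxu)
    refine ⟨s, hxs, hsu.trans (R.reg_part_subset hu), fun T hT => hs T ?_⟩
    rw [← subdivide_level]
    exact ⟨S, hT, u, hu, rfl⟩

/-! ### Forcing the border propagates to balls of any radius -/

/-- Border forcing in terms of hierarchies, for supertiles in equal positions. -/
theorem ForcesBorder.exists_level (hborder : R.ForcesBorder) (n : ℕ) :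
    ∃ N, ∀ (T T' : R.TilingSpace 0) (S : R.STile N), S ∈ (level hrec T N).tiles →
      S ∈ (level hrec T' N).tiles → ∀ t ∈ (level hrec T n).tiles,
      (R.reg n t ∩ R.reg N S).Nonempty → t ∈ (level hrec T' n).tiles := by
  obtain ⟨N, hN⟩ := hborder n
  refine ⟨N, fun T T' S hS hS' t ht htS => ?_⟩
  have h := hN T T' (level hrec T n) (level hrec T' n) (level hrec T N) (level hrec T' N)
    (toBase_level hrec _ _) (toBase_level hrec _ _) (toBase_level hrec _ _)
    (toBase_level hrec _ _) S hS S hS' rfl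
  have h1 : t ∈ translate (S.2 - S.2) '' touching (R.supp n) (level hrec T n).tiles (R.reg N S) :=
    ⟨t, ⟨ht, htS⟩, by rw [sub_self, translate_zero]⟩
  rw [h] at h1
  exact h1.1

/-- There are a level `N` and a distance `r > 0` such that in every tiling a tile at distance less
than `r` from an `N`-supertile meets it. Border forcing reduces this to finitely many
configurations: the tiles which meet an `N`-supertile are determined by its type, and they cover a
neighbourhood of it. -/
theorem ForcesBorder.exists_meets_of_dist_lt (hborder : R.ForcesBorder) :
    ∃ N, ∃ r > 0, ∀ (T : R.TilingSpace 0), ∀ S ∈ (level hrec T N).tiles, ∀ t ∈ T.tiles,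
      ∀ x ∈ R.reg N S, ∀ y ∈ R.reg 0 t, dist y x < r → (R.reg 0 t ∩ R.reg N S).Nonempty := by
  obtain ⟨N, hN⟩ := hborder 0
  have key : ∀ j : Fin (R.num N), ∃ r > 0, ∀ (T : R.TilingSpace 0),
      ∀ S ∈ (level hrec T N).tiles, S.1 = j →
        thickening r (R.reg N S) ⊆ ⋃ t ∈ touching (R.supp 0) T.tiles (R.reg N S), R.reg 0 t := by
    intro j
    by_cases hj : ∃ T : R.TilingSpace 0, ∃ S ∈ (level hrec T N).tiles, S.1 = j
    · obtain ⟨T₀, S₀, hS₀, rfl⟩ := hj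
      obtain ⟨r, hr, h⟩ := R.exists_thickening_subset T₀.isTiling (R.isCompact_reg N S₀)
      refine ⟨r, hr, fun T S hS hj y hy => ?_⟩
      have heq := hN T₀ T T₀ T (level hrec T₀ N) (level hrec T N) rfl (toBase_level hrec _ _) rfl
        (toBase_level hrec _ _) S₀ hS₀ S hS hj.symm
      rw [← heq, biUnion_region_image_translate, mem_vadd_set_iff_neg_vadd_mem]
      refine h ?_
      obtain ⟨z, hz, hyz⟩ := mem_thickening_iff.1 hy
      refine mem_thickening_iff.2 ⟨-(S.2 - S₀.2) +ᵥ z, ?_, by rwa [dist_vadd_cancel_left]⟩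
      have hz' := mem_region.1 hz
      rw [hj] at hz'
      rw [reg, mem_region, vadd_eq_add]
      convert hz' using 1
      abel
    · exact ⟨1, one_pos, fun T S hS hSj => absurd ⟨T, S, hS, hSj⟩ hj⟩
  choose f hf0 hf using key
  obtain ⟨r, hr, hrf⟩ : ∃ r > 0, ∀ j, r ≤ f j := by
    rcases isEmpty_or_nonempty (Fin (R.num N)) with he | he
    · exact ⟨1, one_pos, fun j => (he.false j).elim⟩
    · obtain ⟨j₀, hj₀⟩ := Finite.exists_min f
      exact ⟨f j₀, hf0 j₀, hj₀⟩
  refine ⟨N, r, hr, fun T S hS t ht x hx y hy hyx => ?_⟩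
  by_contra hn
  have hyS : y ∈ thickening (f S.1) (R.reg N S) :=
    mem_thickening_iff.2 ⟨x, hx, hyx.trans_le (hrf _)⟩
  -- A tile is the closure of its interior, so that if `t` is not among the tiles meeting `S`, an
  -- interior point of `t` near `y` is a limit of interior points of such a tile.
  obtain ⟨z, hz, hzt⟩ := mem_closure_iff.1 (R.reg_zero_subset_closure_interior t hy) _
    isOpen_thickening hyS
  have hzc := hf S.1 T S hS rfl hz
  simp only [mem_iUnion, exists_prop] at hzc
  obtain ⟨u, hu, hzu⟩ := hzc
  obtain ⟨w, hwt, hwu⟩ := mem_closure_iff.1 (R.reg_zero_subset_closure_interior u hzu) _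
    isOpen_interior hzt
  have hne : t ≠ u := by
    rintro rfl
    exact hn hu.2
  exact Set.disjoint_left.1 (T.isTiling.1 ht hu.1 hne) hwt hwu

/-- An `N`-supertile of a tiling which contains the point `x` determines the `n`-supertiles which
meet the closed ball of radius `ρ` around `x`. -/
def Determines (n N : ℕ) (ρ : ℝ) : Prop :=
  ∀ (T T' : R.TilingSpace 0) (S : R.STile N), S ∈ (level hrec T N).tiles →
    S ∈ (level hrec T' N).tiles → ∀ x ∈ R.reg N S, ∀ t ∈ (level hrec T n).tiles,
    ∀ y ∈ R.reg n t, dist y x ≤ ρ → t ∈ (level hrec T' n).tiles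

variable {hrec}

theorem Determines.add {n M N : ℕ} {ρ r : ℝ} (hρ : 0 ≤ ρ) (hr : 0 ≤ r)
    (h : Determines hrec n M ρ) (h' : Determines hrec M N r) : Determines hrec n N (r + ρ) := by
  intro T T' S hS hS' x hx t ht y hy hyx
  obtain ⟨z, hyz, hzx⟩ := exists_dist_le_le hρ hr hyx
  obtain ⟨s, hs, hzs⟩ := (level hrec T M).isTiling.exists_mem z
  exact h T T' s hs (h' T T' S hS hS' x hx s hs z hzs hzx) z hzs t ht y hy hyz

variable (hrec)

/-- One step of border forcing controls a ball whose radius does not depend on the level. -/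
theorem ForcesBorder.exists_determines (hborder : R.ForcesBorder) :
    ∃ r > 0, ∀ n, ∃ N, Determines hrec n N r := by
  obtain ⟨N₀, r, hr, hr'⟩ := hborder.exists_meets_of_dist_lt hrec
  refine ⟨r / 2, half_pos hr, fun n => ?_⟩
  obtain ⟨N₁, hN₁⟩ := hborder.exists_level hrec n
  refine ⟨max N₀ N₁, fun T T' S hS hS' x hx t ht y hy hyx => ?_⟩
  obtain ⟨S₀, hxS₀, hS₀S, hS₀⟩ := exists_subtile hrec (le_max_left N₀ N₁) hx
  obtain ⟨t₀, hyt₀, ht₀t, ht₀⟩ := exists_subtile hrec (Nat.zero_le n) hy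
  obtain ⟨z, hzt, hzS⟩ := hr' T S₀ (hS₀ T hS) t₀ (ht₀ T ht) x hxS₀ y hyt₀
    (hyx.trans_lt (half_lt_self hr))
  obtain ⟨s, hzs, -, hs⟩ := exists_subtile hrec (le_max_right N₀ N₁) (hS₀S hzS)
  exact hN₁ T T' s (hs T hS) (hs T' hS') t ht ⟨z, ht₀t hzt, hzs⟩

/-- Supertiles of a sufficiently high level determine the `n`-supertiles in a ball of any
prescribed radius, even if the supertiles themselves do not grow. -/
theorem ForcesBorder.exists_determines_radius (hborder : R.ForcesBorder) (n : ℕ) (ρ : ℝ) :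
    ∃ N, Determines hrec n N ρ := by
  obtain ⟨r, hr, h⟩ := hborder.exists_determines hrec
  have key : ∀ k : ℕ, ∀ n, ∃ N, Determines hrec n N (r + k * r) := by
    intro k
    induction k with
    | zero => simpa using h
    | succ k ih =>
      intro n
      obtain ⟨M, hM⟩ := ih n
      obtain ⟨N, hN⟩ := h M
      refine ⟨N, ?_⟩
      have := hM.add (by positivity) hr.le hN
      convert this using 1
      push_cast
      ring
  obtain ⟨k, hk⟩ := exists_nat_ge (ρ / r)
  obtain ⟨N, hN⟩ := key k n
  refine ⟨N, fun T T' S hS hS' x hx t ht y hy hyx => hN T T' S hS hS' x hx t ht y hy ?_⟩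
  have := (div_le_iff₀ hr).1 hk
  linarith

/-! ### The point of the Anderson–Putnam complex below the origin -/

/-- The point `x` of the `n`-supertile of type `j`. -/
def cell {n : ℕ} (j : Fin (R.num n)) (hj : R.Occurs n j) (x : Space d) (hx : x ∈ R.supp n j) :
    R.Cells n :=
  ⟨⟨j, hj⟩, ⟨x, hx⟩⟩

theorem TilingSpace.occurs {n : ℕ} (A : R.TilingSpace n) {t : R.STile n} (ht : t ∈ A.tiles) :
    R.Occurs n t.1 :=
  ⟨A, t.2, ht⟩

theorem neg_mem_supp {n : ℕ} {t : R.STile n} (h : (0 : Space d) ∈ R.reg n t) :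
    -t.2 ∈ R.supp n t.1 := by
  simpa using mem_region.1 h

/-- The point of the Anderson–Putnam complex given by the place of the origin in the tiling
`A`, that is, in any supertile of `A` which contains the origin. -/
noncomputable def originClass {n : ℕ} (A : R.TilingSpace n) : R.Complex n :=
  Quot.mk _ (cell _ (A.occurs (A.isTiling.exists_mem 0).choose_spec.1) _
    (neg_mem_supp (A.isTiling.exists_mem 0).choose_spec.2))

theorem originClass_eq {n : ℕ} (A : R.TilingSpace n) {t : R.STile n} (ht : t ∈ A.tiles)
    (h0 : (0 : Space d) ∈ R.reg n t) :
    originClass A = Quot.mk _ (cell t.1 (A.occurs ht) (-t.2) (neg_mem_supp h0)) :=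
  Quot.sound ⟨A, _, _, (A.isTiling.exists_mem 0).choose_spec.1, ht,
    (add_neg_cancel _).trans (add_neg_cancel _).symm⟩

theorem forget_originClass {n : ℕ} (A : R.TilingSpace (n + 1)) :
    R.forget n (originClass A) = originClass (R.subdivide n A) := by
  obtain ⟨t, ht, h0⟩ := A.isTiling.exists_mem 0
  obtain ⟨u, hu, hu0⟩ := R.exists_part (neg_mem_supp h0)
  have hu' : (0 : Space d) ∈ R.reg n (translate t.2 u) := by
    rw [reg, mem_region_translate, zero_sub]
    exact hu0
  rw [originClass_eq A ht h0, forget_mk R _ u hu hu0,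
    originClass_eq (R.subdivide n A) ⟨t, ht, u, hu, rfl⟩ hu']
  have h : ∀ (x y : Space d) (hx : x ∈ R.supp n u.1) (hy : y ∈ R.supp n u.1) (ho : R.Occurs n u.1),
      x = y → Quot.mk (R.Meet n) (cell u.1 ho x hx) = Quot.mk _ (cell u.1 ho y hy) := by
    rintro x _ hx hy ho rfl
    rfl
  exact h _ _ _ _ _ (neg_add' t.2 u.2).symm

/-- Every point of an occurring supertile can be placed at the origin of some tiling. -/
theorem exists_mem_level {n : ℕ} (p : R.Cells n) :
    ∃ T : R.TilingSpace 0, (p.1.1, -(p.2 : Space d)) ∈ (level hrec T n).tiles := by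
  obtain ⟨A, v, hA⟩ := p.1.2
  refine ⟨(R.toBase n A).shift (-(p.2 : Space d) - v), ?_⟩
  rw [level_shift, level_toBase]
  exact ⟨_, hA, by simp [translate]⟩

theorem zero_mem_reg {n : ℕ} (p : R.Cells n) :
    (0 : Space d) ∈ R.reg n (p.1.1, -(p.2 : Space d)) := by
  rw [reg, mem_region, zero_sub, neg_neg]
  exact p.2.2

theorem originClass_eq_mk {n : ℕ} {A : R.TilingSpace n} {p : R.Cells n}
    (h : (p.1.1, -(p.2 : Space d)) ∈ A.tiles) : originClass A = Quot.mk _ p := by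
  rw [originClass_eq A h (zero_mem_reg p)]
  obtain ⟨⟨j, hj⟩, ⟨x, hx⟩⟩ := p
  simp only [cell, neg_neg]
  rfl

theorem exists_originClass_eq {n : ℕ} (x : R.Complex n) :
    ∃ T : R.TilingSpace 0, originClass (level hrec T n) = x := by
  obtain ⟨p, rfl⟩ := Quot.exists_rep x
  obtain ⟨T, hT⟩ := exists_mem_level hrec p
  exact ⟨T, originClass_eq_mk hT⟩

variable {hrec}

/-- If `N`-supertiles determine their surroundings, then these depend only on the point of the
Anderson–Putnam complex: identified points of two supertiles occur together in one tiling, which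
agrees with all others around both of them. -/
theorem Determines.mem_of_originClass_eq {n N : ℕ} {ρ : ℝ} (h : Determines hrec n N ρ)
    {T T' : R.TilingSpace 0}
    (hT : originClass (level hrec T N) = originClass (level hrec T' N)) {t : R.STile n}
    (ht : t ∈ (level hrec T n).tiles) {y : Space d} (hy : y ∈ R.reg n t) (hyρ : ‖y‖ ≤ ρ) :
    t ∈ (level hrec T' n).tiles := by
  let D : R.Cells N → Set (R.STile n) := fun p =>
    {t | (∃ y ∈ R.reg n t, ‖y‖ ≤ ρ) ∧ ∃ T : R.TilingSpace 0,
      (p.1.1, -(p.2 : Space d)) ∈ (level hrec T N).tiles ∧ t ∈ (level hrec T n).tiles}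
  have hD : ∀ (p : R.Cells N) (T : R.TilingSpace 0),
      (p.1.1, -(p.2 : Space d)) ∈ (level hrec T N).tiles →
      D p = touching (R.supp n) (level hrec T n).tiles (closedBall 0 ρ) := by
    intro p T hp
    ext t
    constructor
    · rintro ⟨⟨y, hy, hyρ⟩, T₁, hp₁, ht⟩
      exact ⟨h T₁ T _ hp₁ hp 0 (zero_mem_reg p) t ht y hy (by simpa using hyρ), y, hy,
        by simpa using hyρ⟩
    · rintro ⟨ht, y, hy, hyρ⟩
      exact ⟨⟨y, hy, by simpa using hyρ⟩, T, hp, ht⟩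
  have hmeet : ∀ p q, R.Meet N p q → D p = D q := by
    rintro p q ⟨A, v, w, hv, hw, hvw⟩
    have e : ∀ x : R.TilingSpace N, level hrec (R.toBase N x) N = x := level_toBase hrec N
    rw [hD p (R.toBase N (A.shift (-(v + (p.2 : Space d))))), hD q]
    · rw [e]
      exact ⟨_, hw, by rw [hvw]; simp [translate]⟩
    · rw [e]
      exact ⟨_, hv, by simp [translate]⟩
  have hlift : ∀ T : R.TilingSpace 0, Quot.lift D hmeet (originClass (level hrec T N)) =
      touching (R.supp n) (level hrec T n).tiles (closedBall 0 ρ) := by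
    intro T
    obtain ⟨s, hs, h0⟩ := (level hrec T N).isTiling.exists_mem 0
    rw [originClass_eq _ hs h0]
    refine hD _ T ?_
    simpa [cell] using hs
  have heq := hlift T
  rw [hT, hlift T'] at heq
  have hmem : t ∈ touching (R.supp n) (level hrec T n).tiles (closedBall 0 ρ) :=
    ⟨ht, y, hy, by simpa using hyρ⟩
  rw [← heq] at hmem
  exact hmem.1

/-! ### Continuity of the map to the Anderson–Putnam complexes -/

/-- Points near the origin of any tile `t` of `A`, whether or not `t` contains the origin, have
their class in a given neighbourhood of the class of the origin. -/
theorem eventually_cell_mem {n : ℕ} {A : R.TilingSpace n} {U : Set (R.Complex n)} (hU : IsOpen U)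
    (hA : originClass A ∈ U) {t : R.STile n} (ht : t ∈ A.tiles) :
    ∀ᶠ z in 𝓝 (0 : Space d), ∀ hz : z - t.2 ∈ R.supp n t.1,
      (Quot.mk _ (cell t.1 (A.occurs ht) (z - t.2) hz) : R.Complex n) ∈ U := by
  by_cases h0 : (0 : Space d) ∈ R.reg n t
  · have hpre : IsOpen (Sigma.mk (⟨t.1, A.occurs ht⟩ : {j // R.Occurs n j}) ⁻¹'
        (Quot.mk (R.Meet n) ⁻¹' U)) :=
      isOpen_sigma_iff.1 (hU.preimage continuous_quot_mk) _
    obtain ⟨O, hO, hOU⟩ := isOpen_induced_iff.1 hpre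
    have hO0 : (0 : Space d) - t.2 ∈ O := by
      have h : (⟨-t.2, neg_mem_supp h0⟩ : R.supp n t.1) ∈ Subtype.val ⁻¹' O := by
        rw [hOU]
        rw [originClass_eq A ht h0] at hA
        exact hA
      simpa using h
    have hev : ∀ᶠ z in 𝓝 (0 : Space d), z - t.2 ∈ O :=
      (continuous_id.sub continuous_const).continuousAt.eventually_mem (hO.mem_nhds hO0)
    filter_upwards [hev] with z hz hzt
    have h : (⟨z - t.2, hzt⟩ : R.supp n t.1) ∈ Subtype.val ⁻¹' O := hz
    rw [hOU] at h
    exact h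
  · filter_upwards [(R.isCompact_reg n t).isClosed.isOpen_compl.mem_nhds h0] with z hz hzt
    exact absurd (mem_region.2 hzt) hz

theorem continuous_originClass (n : ℕ) :
    Continuous (originClass : R.TilingSpace n → R.Complex n) := by
  refine continuous_def.2 fun U hU A hA => ?_
  have hev : ∀ᶠ z in 𝓝 (0 : Space d), ∀ t ∈ touching (R.supp n) A.tiles (closedBall 0 1),
      ∀ (ho : R.Occurs n t.1) (hz : z - t.2 ∈ R.supp n t.1),
      (Quot.mk _ (cell t.1 ho (z - t.2) hz) : R.Complex n) ∈ U := by
    refine (Filter.eventually_all_finite (R.finite_touching_closedBall A.isTiling 1)).2 ?_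
    intro t ht
    filter_upwards [eventually_cell_mem hU hA ht.1] with z hz _ using hz
  obtain ⟨δ, hδ, h⟩ := Metric.eventually_nhds_iff.1 hev
  -- The origin is displaced by at most `2 * ε`; the bound `2 * ε ≤ 1` also gives `ε ≤ 1 / ε`, so
  -- that the displaced origins lie in the balls on which the tilings agree.
  obtain ⟨ε, hε, hε2, hεδ⟩ : ∃ ε > 0, 2 * ε ≤ 1 ∧ 2 * ε < δ :=
    ⟨min (1 / 2) (δ / 3), by positivity,
      by linarith [min_le_left (1 / 2) (δ / 3)], by linarith [min_le_right (1 / 2) (δ / 3)]⟩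
  refine ⟨ε, hε, fun A' hc => ?_⟩
  obtain ⟨g, g', hg, hg', he⟩ := hc
  obtain ⟨t', ht', h0⟩ := A'.isTiling.exists_mem 0
  have hε1 : ε ≤ 1 / ε := by
    rw [le_div_iff₀ hε]
    nlinarith
  have hmem : translate g' t' ∈
      touching (R.supp n) (translate g' '' A'.tiles) (closedBall 0 (1 / ε)) := by
    refine ⟨⟨t', ht', rfl⟩, g', ?_, ?_⟩
    · rwa [mem_region_translate, sub_self]
    · rw [mem_closedBall_zero_iff]
      exact hg'.trans hε1
  rw [← he] at hmem
  have hA' := mem_image_translate.1 hmem.1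
  rw [translate_translate, neg_add_eq_sub] at hA'
  have hz : ‖g' - g‖ ≤ 2 * ε := (norm_sub_le _ _).trans (by linarith)
  have hzt : g' - g ∈ R.reg n (translate (g' - g) t') := by
    rwa [reg, mem_region_translate, sub_self]
  have hs : g' - g - (translate (g' - g) t').2 = -t'.2 := by simp [translate]
  have hs' : g' - g - (translate (g' - g) t').2 ∈ R.supp n t'.1 := by
    rw [hs]
    exact neg_mem_supp h0
  have ho : R.Occurs n (translate (g' - g) t').1 := ⟨A', t'.2, ht'⟩
  have hfin := h (y := g' - g) (by rw [dist_zero_right]; exact hz.trans_lt hεδ)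
    (translate (g' - g) t') ⟨hA', _, hzt, by rw [mem_closedBall_zero_iff]; exact hz.trans hε2⟩
    ho hs'
  rw [mem_preimage, originClass_eq A' ht' h0]
  simp only [hs] at hfin
  exact hfin

/-! ### The homeomorphism onto the inverse limit -/

variable (hrec)

/-- The point of the inverse limit that records the place of the origin in the `n`-supertiles of
`T`, for all `n`. -/
noncomputable def toInverseLimit (T : R.TilingSpace 0) : R.InverseLimit :=
  ⟨fun n => originClass (level hrec T n), fun n => by
    rw [forget_originClass, subdivide_level]⟩

theorem continuous_toInverseLimit : Continuous (toInverseLimit hrec) :=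
  (continuous_pi fun n => (continuous_originClass n).comp (continuous_level hrec n)).subtype_mk _

theorem originClass_eq_of_le {n N : ℕ} (h : n ≤ N) {x : R.InverseLimit} {T : R.TilingSpace 0}
    (hT : originClass (level hrec T N) = x.1 N) : originClass (level hrec T n) = x.1 n := by
  induction N, h using Nat.le_induction with
  | base => exact hT
  | succ N _ ih =>
    refine ih ?_
    rw [← subdivide_level, ← forget_originClass, hT, x.2]

theorem injective_toInverseLimit (hborder : R.ForcesBorder) :
    Function.Injective (toInverseLimit hrec) := by
  have key : ∀ T T' : R.TilingSpace 0, toInverseLimit hrec T = toInverseLimit hrec T' →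
      T.tiles ⊆ T'.tiles := by
    intro T T' h t ht
    obtain ⟨y, hy⟩ := (R.reg_isConnected 0 t).nonempty
    obtain ⟨N, hN⟩ := hborder.exists_determines_radius hrec 0 ‖y‖
    exact hN.mem_of_originClass_eq (congrFun (congrArg Subtype.val h) N) ht hy le_rfl
  exact fun T T' h => TilingSpace.ext ((key T T' h).antisymm (key T' T h.symm))

/-- Tilings whose higher and higher supertiles sit at the places prescribed by a point of the
inverse limit agree on larger and larger balls, at each level of the hierarchy. Their limits at
the different levels form the hierarchy of a tiling. -/
theorem surjective_toInverseLimit (hborder : R.ForcesBorder) :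
    Function.Surjective (toInverseLimit hrec) := by
  intro x
  choose F hF using fun N => exists_originClass_eq hrec (x.1 N)
  let B : ∀ n, Set (R.STile n) := fun n =>
    {t | ∀ᶠ N in Filter.atTop, t ∈ (level hrec (F N) n).tiles}
  have hB : ∀ (n : ℕ) (y : Space d), ∀ᶠ N in Filter.atTop,
      ∀ t ∈ (level hrec (F N) n).tiles, y ∈ R.reg n t → t ∈ B n := by
    intro n y
    obtain ⟨M, hM⟩ := hborder.exists_determines_radius hrec n ‖y‖
    filter_upwards [Filter.eventually_ge_atTop M] with N hN t ht hy
    filter_upwards [Filter.eventually_ge_atTop M] with N' hN'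
    refine hM.mem_of_originClass_eq ?_ ht hy le_rfl
    rw [originClass_eq_of_le hrec hN (hF N), originClass_eq_of_le hrec hN' (hF N')]
  let A : ∀ n, R.TilingSpace n := fun n =>
    { tiles := B n
      isTiling := by
        refine ⟨fun s hs t ht hst => ?_, eq_univ_of_forall fun y => ?_⟩
        · obtain ⟨N, hsN, htN⟩ := (Filter.Eventually.and hs ht).exists
          exact (level hrec (F N) n).isTiling.1 hsN htN hst
        · obtain ⟨N, hN⟩ := (hB n y).exists
          obtain ⟨t, ht, hy⟩ := (level hrec (F N) n).isTiling.exists_mem y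
          exact mem_biUnion (hN t ht hy) hy
      admitted := by
        intro Q hQB hQ
        obtain ⟨N, hN⟩ := ((Filter.eventually_all_finite hQ.1).2 fun t ht => hQB ht).exists
        exact (level hrec (F N) n).admitted Q hN hQ }
  have hA : ∀ n, R.subdivide n (A (n + 1)) = A n := by
    intro n
    ext t
    constructor
    · rintro ⟨s, hs, u, hu, rfl⟩
      have hs' : ∀ᶠ N in Filter.atTop, s ∈ (level hrec (F N) (n + 1)).tiles := hs
      refine hs'.mono fun N hN => ?_
      rw [← subdivide_level]
      exact ⟨s, hN, u, hu, rfl⟩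
    · intro ht
      have ht' : ∀ᶠ N in Filter.atTop, t ∈ (level hrec (F N) n).tiles := ht
      obtain ⟨y, hy⟩ := (R.reg_isConnected n t).nonempty
      obtain ⟨N, hN, htN⟩ := ((hB (n + 1) y).and ht').exists
      rw [← subdivide_level] at htN
      obtain ⟨s, hs, u, hu, rfl⟩ := htN
      exact ⟨s, hN s hs (R.reg_part_subset hu hy), u, hu, rfl⟩
  refine ⟨A 0, Subtype.ext (funext fun n => ?_)⟩
  change originClass (level hrec (A 0) n) = x.1 n
  rw [level_eq hrec hA]
  obtain ⟨s, hs, h0⟩ := (A n).isTiling.exists_mem 0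
  have hs' : ∀ᶠ N in Filter.atTop, s ∈ (level hrec (F N) n).tiles := hs
  obtain ⟨N, hsN, hnN⟩ := (hs'.and (Filter.eventually_ge_atTop n)).exists
  rw [originClass_eq (A n) hs h0, ← originClass_eq (level hrec (F N) n) hsN h0]
  exact originClass_eq_of_le hrec hnN (hF N)

variable {hrec}

theorem Determines.touching_image_translate_eq {N : ℕ} {ρ ε : ℝ}
    (h : Determines hrec 0 N (ρ + ε)) {T T' : R.TilingSpace 0}
    (hT : originClass (level hrec T N) = originClass (level hrec T' N)) {g : Space d}
    (hg : ‖g‖ ≤ ε) :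
    touching (R.supp 0) (translate g '' T.tiles) (closedBall 0 ρ) =
      touching (R.supp 0) (translate g '' T'.tiles) (closedBall 0 ρ) := by
  have key : ∀ T T' : R.TilingSpace 0,
      originClass (level hrec T N) = originClass (level hrec T' N) →
      touching (R.supp 0) (translate g '' T.tiles) (closedBall 0 ρ) ⊆
        touching (R.supp 0) (translate g '' T'.tiles) (closedBall 0 ρ) := by
    rintro T T' hT _ ⟨⟨t, ht, rfl⟩, y, hy, hyρ⟩
    refine ⟨⟨t, ?_, rfl⟩, y, hy, hyρ⟩
    refine h.mem_of_originClass_eq hT ht (mem_region_translate.1 hy) ?_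
    exact (norm_sub_le _ _).trans (add_le_add (mem_closedBall_zero_iff.1 hyρ) hg)
  exact (key T T' hT).antisymm (key T' T hT.symm)

/-- The set of points of the `N`-th complex around which the tiling agrees with `T` on the closed
ball of radius `ρ`, up to a translation by less than `ε`, is open: moving the point within its
supertile translates the tiling. -/
theorem Determines.isOpen_setOf_agree {N : ℕ} {ρ ε : ℝ} (h : Determines hrec 0 N (ρ + ε))
    (T : R.TilingSpace 0) :
    IsOpen {x : R.Complex N | ∃ T' : R.TilingSpace 0, originClass (level hrec T' N) = x ∧
      ∃ g : Space d, ‖g‖ < ε ∧ touching (R.supp 0) T.tiles (closedBall 0 ρ) =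
        touching (R.supp 0) (translate g '' T'.tiles) (closedBall 0 ρ)} := by
  refine isOpen_coinduced.2 (isOpen_sigma_iff.2 fun j => isOpen_iff_mem_nhds.2 ?_)
  rintro q ⟨T₁, hT₁, g, hg, hagree⟩
  obtain ⟨T', hT'⟩ := exists_mem_level hrec (⟨j, q⟩ : R.Cells N)
  rw [h.touching_image_translate_eq (hT₁.trans (originClass_eq_mk hT').symm) hg.le] at hagree
  have hcont : Continuous fun q' : R.supp N j.1 => ‖g + ((q' : Space d) - q)‖ := by fun_prop
  have hev : ∀ᶠ q' : R.supp N j.1 in 𝓝 q, ‖g + ((q' : Space d) - q)‖ < ε :=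
    hcont.continuousAt.eventually_lt_const (by simpa using hg)
  filter_upwards [hev] with q' hq'
  refine ⟨T'.shift (-((q' : Space d) - q)), ?_, _, hq', ?_⟩
  · refine originClass_eq_mk ?_
    rw [level_shift]
    exact ⟨_, hT', Prod.ext rfl (by simp only [translate]; abel)⟩
  · rw [hagree, TilingSpace.shift, translate_image_image, add_neg_cancel_right]

variable (hrec)

theorem isOpenMap_toInverseLimit (hborder : R.ForcesBorder) :
    IsOpenMap (toInverseLimit hrec) := by
  intro U hU
  refine isOpen_iff_mem_nhds.2 ?_
  rintro _ ⟨T, hT, rfl⟩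
  obtain ⟨ε, hε, hclose⟩ := hU T hT
  obtain ⟨N, hN⟩ := hborder.exists_determines_radius hrec 0 (1 / ε + ε)
  have hcont : Continuous fun x : R.InverseLimit => x.1 N :=
    (continuous_apply N).comp continuous_subtype_val
  refine Filter.mem_of_superset
    (((hN.isOpen_setOf_agree T).preimage hcont).mem_nhds ⟨T, rfl, 0, by simpa using hε, ?_⟩) ?_
  · simp
  · rintro x ⟨T₁, hT₁, g, hg, hagree⟩
    obtain ⟨T', rfl⟩ := surjective_toInverseLimit hrec hborder x
    refine ⟨T', hclose T' ⟨0, g, by simpa using hε.le, hg.le, ?_⟩, rfl⟩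
    rw [← hN.touching_image_translate_eq hT₁ hg.le, ← hagree]
    simp

end FusionRule

end FusionTiling

theorem mainTheorem10 {d : ℕ} (R : FusionTiling.FusionRule d) (hrec : R.Recognizable)
    (hborder : R.ForcesBorder) :
    Nonempty (R.TilingSpace 0 ≃ₜ R.InverseLimit) :=
  ⟨(Equiv.ofBijective (FusionTiling.FusionRule.toInverseLimit hrec)
    ⟨FusionTiling.FusionRule.injective_toInverseLimit hrec hborder,
      FusionTiling.FusionRule.surjective_toInverseLimit hrec
        hborder⟩).toHomeomorphOfContinuousOpen
    (FusionTiling.FusionRule.continuous_toInverseLimit hrec)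
    (FusionTiling.FusionRule.isOpenMap_toInverseLimit hrec hborder)⟩
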